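/- Let $\mathcal X$ be a measurable space (for example a Borel subset of $\mathbb R^d$), let $c\ge 1$ be the number of labels and $n\ge 1$ the sample size, and let $D$ be a probability distribution on $\mathcal X\times\{-1,+1\}^c$. Let $\kappa:\mathcal X\times\mathcal X\to\mathbb R$ be a measurable positive semidefinite symmetric kernel with $\kappa(x,x)\le r^2$ for all $x\in\mathcal X$, for some $r>0$, and let $\phi:\mathcal X\to\mathbb H$ be a feature map of $\kappa$ into a real Hilbert space $\mathbb H$ (for example the reproducing kernel Hilbert space of $\kappa$), i.e. $\kappa(x,x')=\langle\phi(x),\phi(x')\rangle$. For $\Lambda\in\mathbb R$ consider the hypothesis set $$\mathcal F=\Big\{x\mapsto(\langle w_1,\phi(x)\rangle,\dots,\langle w_c,\phi(x)\rangle)\;:\;w_1,\dots,w_c\in\mathbb H,\ \Big(\sum_{j=1}^c\|w_j\|^2\Big)^{1/2}\le\Lambda\Big\}.$$ Put $\mathrm{sgn}(u)=1$ if $u>0$ and $\mathrm{sgn}(u)=-1$ otherwise. Let $\ell:\mathbb R\to\mathbb R$ be a base loss that is $\rho$-Lipschitz, upper bounds the 0/1 loss, i.e. $[\![\mathrm{sgn}(u)\ne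 b]\!]\le\ell(bu)$ for all $u\in\mathbb R$ and $b\in\{-1,+1\}$, and is bounded by $B$ on the arguments that occur, i.e. $\ell(b f_j(x))\le B$ for all $f\in\mathcal F$, $x\in\mathcal X$, $1\le j\le c$ and $b\in\{-1,+1\}$. Define the surrogate subset loss $L_s(v,y)=\max_{1\le j\le c}\ell(y_jv_j)$ for $v\in\mathbb R^c$ and $y\in\{-1,+1\}^c$, and for $f\in\mathcal F$ and a sample $S=((x_i,y_i))_{i=1}^n$ define $$\hat R^s_S(f)=\frac1n\sum_{i=1}^nL_s(f(x_i),y_i),\qquad R^h_{0/1}(\mathrm{sgn}\circ f)=\mathbb E_{(x,y)\sim D}\Big[\frac1c\sum_{j=1}^c[\![\mathrm{sgn}(f_j(x))\ne y_j]\!]\Big],$$ $$R^s_{0/1}(\mathrm{sgn}\circ f)=\mathbb E_{(x,y)\sim D}\Big[\max_{1\le j\le c}[\![\mathrm{sgn}(f_j(x))\ne y_j]\!]\Big].$$ Then $L_s(\cdot,y)$ is $\rho$-Lipschitz with respect to the Euclidean norm for every $y\in\{-1,+1\}^c$, the two expectations above exist for every $f\in\mathcal F$, and for every $\delta>0$,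 with probability at least $1-\delta$ over the draw of an i.i.d. sample $S$ of size $n$ from $D$, the following holds simultaneously for all $f\in\mathcal F$: $$R^h_{0/1}(\mathrm{sgn}\circ f)\;\le\;R^s_{0/1}(\mathrm{sgn}\circ f)\;\le\;\hat R^s_S(f)+2\sqrt2\,\rho\sqrt{\frac{c\Lambda^2r^2}{n}}+3B\sqrt{\frac{\log(2/\delta)}{2n}}.$$ -/

import Mathlib

open MeasureTheory

open scoped NNReal InnerProductSpace

namespace MultiLabel

noncomputable section

/-- A single label, an element of the two-point set `{-1, +1} ⊆ ℝ`. -/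
abbrev Label : Type := ({-1, 1} : Set ℝ)

/-- Label vectors, the elements of `{-1, +1}^c`. -/
abbrev LabelVec (c : ℕ) : Type := Fin c → Label

/-- Score vectors, the elements of `ℝ^c` with the Euclidean norm. -/
abbrev ScoreVec (c : ℕ) : Type := EuclideanSpace ℝ (Fin c)

/-- `sgn u = 1` when `u > 0`, and `sgn u = -1` otherwise. -/
def sgn (u : ℝ) : Label := if 0 < u then ⟨1, by simp⟩ else ⟨-1, by simp⟩

/-- The classifier `sgn ∘ f` induced by a score function `f`. -/
def signClassifier {𝒳 : Type*} {c : ℕ} (f : 𝒳 → ScoreVec c) : 𝒳 → LabelVec c :=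
  fun x j => sgn (f x j)

open Classical in
/-- The 0/1 loss of a predicted label `a` against the true label `b`: the indicator of `a ≠ b`. -/
def zeroOne (a b : Label) : ℝ := if a ≠ b then 1 else 0

/-- Hamming loss: the average over the labels of the 0/1 losses. -/
def hammingLoss {c : ℕ} (h y : LabelVec c) : ℝ := (1 / (c : ℝ)) * ∑ j, zeroOne (h j) (y j)

/-- Subset loss: the maximum over the labels of the 0/1 losses
(the supremum of a finite nonempty family when `1 ≤ c`). -/
def subsetLoss {c : ℕ} (h y : LabelVec c) : ℝ := ⨆ j, zeroOne (h j) (y j)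

/-- The surrogate subset loss with base loss `ℓ`: the maximum over the labels of `ℓ (y_j v_j)`
(the supremum of a finite nonempty family when `1 ≤ c`). -/
def subsetSurrogate {c : ℕ} (ℓ : ℝ → ℝ) (v : ScoreVec c) (y : LabelVec c) : ℝ :=
  ⨆ j, ℓ ((y j : ℝ) * v j)

/-- The base loss `ℓ` upper bounds the 0/1 loss of the sign classifier. -/
def DominatesZeroOne (ℓ : ℝ → ℝ) : Prop :=
  ∀ (u : ℝ) (b : Label), zeroOne (sgn u) b ≤ ℓ ((b : ℝ) * u)

/-- The 0/1 risk of a classifier `h` under the distribution `D`, for the loss `L01`. -/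
def trueRisk {𝒳 : Type*} [MeasurableSpace 𝒳] {c : ℕ} (D : Measure (𝒳 × LabelVec c))
    (L01 : LabelVec c → LabelVec c → ℝ) (h : 𝒳 → LabelVec c) : ℝ :=
  ∫ z, L01 (h z.1) z.2 ∂D

/-- The empirical risk of a score function `f` on the sample `S`, for the surrogate loss `L`. -/
def empiricalRisk {𝒳 : Type*} {c n : ℕ} (L : ScoreVec c → LabelVec c → ℝ)
    (S : Fin n → 𝒳 × LabelVec c) (f : 𝒳 → ScoreVec c) : ℝ :=
  (1 / (n : ℝ)) * ∑ i, L (f (S i).1) (S i).2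

/-- `φ` is a feature map of the kernel `κ` in the Hilbert space `H`
(for instance `x ↦ κ (x, ·)` in the reproducing kernel Hilbert space of `κ`). -/
def IsFeatureMap {𝒳 H : Type*} [NormedAddCommGroup H] [InnerProductSpace ℝ H]
    (κ : 𝒳 → 𝒳 → ℝ) (φ : 𝒳 → H) : Prop :=
  ∀ x x', κ x x' = ⟪φ x, φ x'⟫_ℝ

/-- The hypothesis set of the functions `x ↦ (⟪w_1, φ x⟫, …, ⟪w_c, φ x⟫)` with
`(∑ j, ‖w_j‖ ^ 2) ^ (1/2) ≤ Λ`; the norm of `PiLp 2` is exactly this one. -/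
def kernelClass {𝒳 H : Type*} [NormedAddCommGroup H] [InnerProductSpace ℝ H]
    (c : ℕ) (φ : 𝒳 → H) (Λ : ℝ) : Set (𝒳 → ScoreVec c) :=
  {f | ∃ W : PiLp 2 (fun _ : Fin c => H), ‖W‖ ≤ Λ ∧ ∀ x j, f x j = ⟪W j, φ x⟫_ℝ}

/-- Over the draw of an i.i.d. sample `S` of size `n` from `D`, the property `P S` holds with
probability at least `p`: some event of probability at least `p` implies it. -/
def HoldsWithProb {Z : Type*} [MeasurableSpace Z] (D : Measure Z) (n : ℕ) (p : ℝ)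
    (P : (Fin n → Z) → Prop) : Prop :=
  ∃ E : Set (Fin n → Z), MeasurableSet E ∧ p ≤ (Measure.pi fun _ : Fin n => D).real E ∧
    ∀ S ∈ E, P S

end

end MultiLabel

open MultiLabel

open scoped BigOperators

namespace MultiLabel

/-! The surrogate dominates the subset loss, which dominates the Hamming loss, so it suffices to
bound the surrogate risk uniformly over a ball of weights. A single exponential-moment argument does
this. Jensen's inequality passes from the deviation of the risk to the gap between a ghost sample
and the sample (`ofReal_exp_deviation_le`). Exchanging the two copies of each example inserts random
signs (`lintegral_expGapSup_le`). For a fixed double sample, bounded differences in the signs alone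
(`expect_exp_le_of_bounded_differences`) leave a Rademacher average plus a sub-Gaussian term, and
Markov's inequality concludes (`holdsWithProb_surrogate_risk_le`).

The Rademacher average is small because a maximum of `ρ`-Lipschitz functions is `ρ`-Lipschitz in the
sup norm: `exists_contraction` trades one sign per example for one sign per score at cost `ρ`.
Cauchy–Schwarz and orthogonality of signs then give `ρ * Λ * √(c * n * r ^ 2)` for each half of the
double sample.

The supremum over the ball is uncountable and `H` may be nonseparable. On a given double sample,
however, all scores come from combinations of its own features (`exists_featureCombination`), and by
continuity rational coefficients suffice. This makes `expGapSup` a countable, measurable supremum.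
-/

/-- The sign `±1` encoded by a Boolean. -/
def boolSign (b : Bool) : ℝ := if b then 1 else -1

@[simp] lemma boolSign_not (b : Bool) : boolSign (!b) = -boolSign b := by
  cases b <;> simp [boolSign]

/-! ### Averages over the sign cube and vector contraction -/

lemma expect_fin_succ_arrow {α : Type*} [Fintype α] (n : ℕ)
    (F : (Fin (n + 1) → α) → ℝ) :
    𝔼 σ, F σ = 𝔼 a, 𝔼 τ : Fin n → α, F (Fin.cons a τ) := by
  rw [← Finset.expect_product' Finset.univ Finset.univ
    (fun a (τ : Fin n → α) => F (Fin.cons a τ)), Finset.univ_product_univ]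
  exact (Fintype.expect_equiv (Fin.consEquiv fun _ => α) _ _ fun _ => rfl).symm

lemma expect_bool (g : Bool → ℝ) : 𝔼 b, g b = (g true + g false) / 2 := by
  rw [Fintype.expect_eq_sum_div_card]
  simp

/-- Averages over the cube are invariant under flipping one coordinate. -/
lemma expect_flip {κ : Type*} [Fintype κ] [DecidableEq κ] (j : κ) (F : (κ → Bool) → ℝ) :
    𝔼 ε, F (Function.update ε j (!ε j)) = 𝔼 ε, F ε := by
  have hinv : Function.Involutive fun ε : κ → Bool => Function.update ε j (!ε j) := by
    intro ε
    simp
  exact Fintype.expect_equiv hinv.toPerm _ _ fun _ => rfl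

lemma expect_coordinate {κ : Type*} [Fintype κ] [DecidableEq κ] (j : κ) (g : Bool → ℝ) :
    𝔼 ε : κ → Bool, g (ε j) = (g true + g false) / 2 := by
  have h1 : 𝔼 ε : κ → Bool, g (!ε j) = 𝔼 ε : κ → Bool, g (ε j) := by
    simpa using expect_flip j (fun ε : κ → Bool => g (ε j))
  have h2 : 𝔼 ε : κ → Bool, (g (ε j) + g (!ε j)) = g true + g false := by
    rw [Finset.expect_congr rfl (g := fun _ => g true + g false)]
    · exact Finset.expect_const Finset.univ_nonempty _
    · intro ε _
      cases ε j <;> simp [add_comm]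
  rw [Finset.expect_add_distrib, h1] at h2
  linarith

lemma expect_boolSign_mul_eq_zero {κ : Type*} [Fintype κ] [DecidableEq κ] {j k : κ} (hjk : k ≠ j)
    (g : Bool → ℝ) : 𝔼 ε : κ → Bool, boolSign (ε k) * g (ε j) = 0 := by
  have h := expect_flip k (fun ε : κ → Bool => boolSign (ε k) * g (ε j))
  simp only [Function.update_self, boolSign_not, Function.update_of_ne hjk.symm, neg_mul,
    Finset.expect_neg_distrib] at h
  linarith

/-- One step of the vector contraction principle: a sign multiplying a function that is Lipschitz
in the sup norm of `v` may be replaced by independent signs multiplying the coordinates of `v`. -/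
lemma exists_contraction_step {T κ : Type*} [Fintype κ] [DecidableEq κ] {ρ : ℝ}
    (h ψ : T → ℝ) (v : κ → T → ℝ)
    (hψ : ∀ s t, ∃ j, |ψ s - ψ t| ≤ ρ * |v j s - v j t|) (t : Bool → T) :
    ∃ τ : (κ → Bool) → T,
      𝔼 b, (h (t b) + boolSign b * ψ (t b)) ≤
        𝔼 ε, (h (τ ε) + ρ * ∑ k, boolSign (ε k) * v k (τ ε)) := by
  obtain ⟨j, hj⟩ := hψ (t true) (t false)
  obtain ⟨η, hη⟩ : ∃ η : Bool, |v j (t true) - v j (t false)| =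
      boolSign η * (v j (t true) - v j (t false)) := by
    rcases abs_cases (v j (t true) - v j (t false)) with ⟨e, _⟩ | ⟨e, _⟩
    · exact ⟨true, by rw [e]; simp [boolSign]⟩
    · exact ⟨false, by rw [e]; simp [boolSign]⟩
  -- The selection depends on `ε` only through `ε j`, so every coordinate other than `j` averages to
  -- zero. Aligning `ε j` with the sign `η` of the difference makes coordinate `j` contribute half
  -- of `|v j (t true) - v j (t false)|`.
  refine ⟨fun ε => t (ε j == η), ?_⟩
  rw [Finset.expect_add_distrib, Finset.expect_add_distrib, ← Finset.mul_expect,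
    Finset.expect_sum_comm,
    Finset.sum_eq_single j (fun k _ hk =>
      expect_boolSign_mul_eq_zero hk fun b => v k (t (b == η))) (by simp),
    expect_coordinate j (fun b => h (t (b == η))),
    expect_coordinate j (fun b => boolSign b * v j (t (b == η))), expect_bool,
    expect_bool]
  have := (le_abs_self _).trans hj
  rw [hη] at this
  cases η <;> simp [boolSign] at this ⊢ <;> linarith

/-- The vector contraction principle, for averages along selections. -/
lemma exists_contraction {T κ : Type*} [Fintype κ] [DecidableEq κ] {ρ : ℝ} (n : ℕ) :
    ∀ (h : T → ℝ) (ψ : Fin n → T → ℝ) (v : Fin n → κ → T → ℝ),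
    (∀ i s t, ∃ j, |ψ i s - ψ i t| ≤ ρ * |v i j s - v i j t|) →
    ∀ t : (Fin n → Bool) → T, ∃ τ : (Fin n → κ → Bool) → T,
      𝔼 σ, (h (t σ) + ∑ i, boolSign (σ i) * ψ i (t σ)) ≤
        𝔼 ε, (h (τ ε) + ρ * ∑ i, ∑ k, boolSign (ε i k) * v i k (τ ε)) := by
  induction n with
  | zero =>
    intro h ψ v _ t
    refine ⟨fun _ => t default, ?_⟩
    simp only [Finset.univ_eq_empty, Finset.sum_empty, add_zero, mul_zero,
      Finset.expect_const Finset.univ_nonempty]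
    exact Finset.expect_le Finset.univ_nonempty fun σ _ => by rw [Subsingleton.elim σ default]
  | succ n ih =>
    intro h ψ v hψ t
    -- The arbitrary offset `h` makes the induction work: it absorbs the first sign while the others
    -- are contracted, then the contracted terms while the first is treated.
    have h1 := fun b : Bool => ih (fun s => h s + boolSign b * ψ 0 s) (fun i => ψ i.succ)
      (fun i => v i.succ) (fun i => hψ i.succ) (fun σ => t (Fin.cons b σ))
    choose τ hτ using h1
    have h2 := fun ε : Fin n → κ → Bool => exists_contraction_step
      (fun s => h s + ρ * ∑ i, ∑ k, boolSign (ε i k) * v i.succ k s) (ψ 0) (v 0) (hψ 0)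
      (fun b => τ b ε)
    choose τ' hτ' using h2
    refine ⟨fun ε => τ' (Fin.tail ε) (ε 0), ?_⟩
    rw [expect_fin_succ_arrow, expect_fin_succ_arrow]
    calc _ ≤ 𝔼 b, 𝔼 ε : Fin n → κ → Bool, ((h (τ b ε) + boolSign b * ψ 0 (τ b ε)) +
          ρ * ∑ i, ∑ k, boolSign (ε i k) * v i.succ k (τ b ε)) := by
          refine Finset.expect_le_expect fun b _ => le_trans (le_of_eq ?_) (hτ b)
          refine Finset.expect_congr rfl fun σ _ => ?_
          simp [Fin.sum_univ_succ, add_assoc]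
      _ = 𝔼 ε : Fin n → κ → Bool, 𝔼 b, ((h (τ b ε) +
          ρ * ∑ i, ∑ k, boolSign (ε i k) * v i.succ k (τ b ε)) + boolSign b * ψ 0 (τ b ε)) := by
          rw [Finset.expect_comm]
          refine Finset.expect_congr rfl fun ε _ => Finset.expect_congr rfl fun b _ => ?_
          ring
      _ ≤ _ := Finset.expect_le_expect fun ε _ => hτ' ε
      _ = _ := by
          rw [Finset.expect_comm]
          refine Finset.expect_congr rfl fun ε _ => Finset.expect_congr rfl fun b _ => ?_
          simp only [Fin.tail_cons, Fin.cons_zero, Fin.sum_univ_succ, Fin.cons_succ]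
          ring

/-! ### Concentration and second moments on the cube -/

/-- A bounded-differences inequality on the cube. -/
lemma expect_exp_le_of_bounded_differences (n : ℕ) (l d : ℝ) :
    ∀ X : (Fin n → Bool) → ℝ, (∀ σ i b, X (Function.update σ i b) ≤ X σ + d) →
    𝔼 σ, Real.exp (l * X σ) ≤ Real.exp (l * 𝔼 σ, X σ + n * (l * d) ^ 2 / 8) := by
  induction n with
  | zero =>
    intro X _
    simp
  | succ n ih =>
    intro X hX
    have h1 := fun b : Bool => ih (fun τ => X (Fin.cons b τ)) (by
      intro σ i b'
      have := hX (Fin.cons b σ) i.succ b'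
      rwa [← Fin.cons_update] at this)
    have h2 : ∀ b b' : Bool, 𝔼 τ : Fin n → Bool, X (Fin.cons b τ) ≤
        𝔼 τ : Fin n → Bool, X (Fin.cons b' τ) + d := by
      intro b b'
      calc _ ≤ 𝔼 τ : Fin n → Bool, (X (Fin.cons b' τ) + d) := by
            refine Finset.expect_le_expect fun τ _ => ?_
            have := hX (Fin.cons b' τ) 0 b
            rwa [Fin.update_cons_zero] at this
        _ = _ := by
            rw [Finset.expect_add_distrib, Finset.expect_const Finset.univ_nonempty]
    rw [expect_fin_succ_arrow, expect_fin_succ_arrow n X]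
    set m : Bool → ℝ := fun b => 𝔼 τ : Fin n → Bool, X (Fin.cons b τ) with hm
    -- A two-point average of exponentials is the exponential of the mean times `cosh` of the
    -- half-difference, and `cosh x ≤ exp (x ^ 2 / 2)`. Each coordinate thus costs `(l * d) ^ 2 /
    -- 8`.
    have h3 : |l * (m true - m false) / 2| ≤ |l * d / 2| := by
      have : |m true - m false| ≤ |d| := by
        refine le_trans (abs_sub_le_iff.2 ⟨?_, ?_⟩) (le_abs_self d)
        · linarith [h2 true false]
        · linarith [h2 false true]
      rw [mul_div_assoc, mul_div_assoc, abs_mul, abs_mul, abs_div, abs_div]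
      gcongr
    calc _ ≤ 𝔼 b, Real.exp (l * m b + n * (l * d) ^ 2 / 8) :=
          Finset.expect_le_expect fun b _ => h1 b
      _ = Real.exp (l * 𝔼 b, m b + n * (l * d) ^ 2 / 8) *
            Real.cosh (l * (m true - m false) / 2) := by
          rw [expect_bool, expect_bool, Real.cosh_eq, mul_div_assoc', mul_add, ← Real.exp_add,
            ← Real.exp_add]
          congr 3 <;> ring
      _ ≤ Real.exp (l * 𝔼 b, m b + n * (l * d) ^ 2 / 8) * Real.exp ((l * d / 2) ^ 2 / 2) := by
          gcongr
          refine (Real.cosh_le_exp_half_sq _).trans (Real.exp_le_exp.2 ?_)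
          have := sq_le_sq.2 h3
          linarith
      _ = _ := by
          rw [← Real.exp_add]
          congr 1
          push_cast
          ring

/-- Cross terms cancel by the parallelogram law, one sign at a time. The free offset `a` carries the
terms already exposed. -/
lemma expect_norm_add_sum_boolSign_smul_sq {H κ : Type*} [NormedAddCommGroup H]
    [InnerProductSpace ℝ H] [Fintype κ] [DecidableEq κ] (j : κ) (n : ℕ) :
    ∀ (a : H) (u : Fin n → H),
    𝔼 ε : Fin n → κ → Bool, ‖a + ∑ i, boolSign (ε i j) • u i‖ ^ 2 =
      ‖a‖ ^ 2 + ∑ i, ‖u i‖ ^ 2 := by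
  induction n with
  | zero =>
    intro a u
    simp
  | succ n ih =>
    intro a u
    rw [expect_fin_succ_arrow]
    calc _ = 𝔼 e : κ → Bool, (‖a + boolSign (e j) • u 0‖ ^ 2 + ∑ i : Fin n, ‖u i.succ‖ ^ 2) := by
          refine Finset.expect_congr rfl fun e _ => ?_
          rw [← ih]
          refine Finset.expect_congr rfl fun ε _ => ?_
          simp [Fin.sum_univ_succ, add_assoc]
      _ = _ := by
          rw [expect_coordinate j (fun b => ‖a + boolSign b • u 0‖ ^ 2 +
            ∑ i : Fin n, ‖u i.succ‖ ^ 2), Fin.sum_univ_succ]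
          have := parallelogram_law_with_norm ℝ a (u 0)
          simp only [boolSign, if_true, one_smul, neg_smul, ← sub_eq_add_neg, Bool.false_eq_true,
            if_false]
          linarith

/-! ### Comparison, Lipschitz continuity and measurability of the losses -/

section Losses

variable {c : ℕ}

lemma label_eq_or (b : Label) : (b : ℝ) = -1 ∨ (b : ℝ) = 1 := by
  exact b.2

lemma abs_label (b : Label) : |(b : ℝ)| = 1 := by
  rcases label_eq_or b with h | h <;> simp [h]

lemma zeroOne_nonneg (a b : Label) : 0 ≤ zeroOne a b := by
  unfold zeroOne; split_ifs <;> norm_num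

lemma zeroOne_le_one (a b : Label) : zeroOne a b ≤ 1 := by
  unfold zeroOne; split_ifs <;> norm_num

/-- The witness is a label attaining the maximum at `v`; multiplying by a label preserves distances.
Naming one coordinate, rather than a norm, is the form contraction needs. -/
lemma subsetSurrogate_le_add [Nonempty (Fin c)] {ℓ : ℝ → ℝ} {ρ : ℝ≥0} (hρ : LipschitzWith ρ ℓ)
    (v v' : ScoreVec c) (y : LabelVec c) :
    ∃ j, subsetSurrogate ℓ v y - subsetSurrogate ℓ v' y ≤ ρ * |v j - v' j| := by
  obtain ⟨j, hj⟩ := exists_eq_ciSup_of_finite (f := fun j => ℓ ((y j : ℝ) * v j))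
  refine ⟨j, ?_⟩
  have h1 : ℓ ((y j : ℝ) * v' j) ≤ subsetSurrogate ℓ v' y :=
    le_ciSup (f := fun j => ℓ ((y j : ℝ) * v' j)) (Set.finite_range _).bddAbove j
  have h2 := hρ.dist_le_mul ((y j : ℝ) * v j) ((y j : ℝ) * v' j)
  rw [Real.dist_eq, Real.dist_eq, ← mul_sub, abs_mul, abs_label, one_mul] at h2
  have h3 : subsetSurrogate ℓ v y = ℓ ((y j : ℝ) * v j) := hj.symm
  linarith [le_abs_self (ℓ ((y j : ℝ) * v j) - ℓ ((y j : ℝ) * v' j))]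

/-- The subset surrogate is Lipschitz with respect to the sup norm. -/
lemma exists_abs_subsetSurrogate_sub_le [Nonempty (Fin c)] {ℓ : ℝ → ℝ} {ρ : ℝ≥0}
    (hρ : LipschitzWith ρ ℓ) (v v' : ScoreVec c) (y : LabelVec c) :
    ∃ j, |subsetSurrogate ℓ v y - subsetSurrogate ℓ v' y| ≤ ρ * |v j - v' j| := by
  rcases abs_cases (subsetSurrogate ℓ v y - subsetSurrogate ℓ v' y) with ⟨e, _⟩ | ⟨e, _⟩
  · rw [e]
    exact subsetSurrogate_le_add hρ v v' y
  · obtain ⟨j, hj⟩ := subsetSurrogate_le_add hρ v' v y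
    refine ⟨j, ?_⟩
    rwa [e, neg_sub, abs_sub_comm]

lemma lipschitzWith_subsetSurrogate [Nonempty (Fin c)] {ℓ : ℝ → ℝ} {ρ : ℝ≥0}
    (hρ : LipschitzWith ρ ℓ) (y : LabelVec c) :
    LipschitzWith ρ fun v : ScoreVec c => subsetSurrogate ℓ v y := by
  refine LipschitzWith.of_dist_le_mul fun v v' => ?_
  obtain ⟨j, hj⟩ := exists_abs_subsetSurrogate_sub_le hρ v v' y
  rw [Real.dist_eq, dist_eq_norm]
  refine hj.trans (mul_le_mul_of_nonneg_left ?_ ρ.2)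
  exact PiLp.norm_apply_le (v - v') j

lemma subsetSurrogate_le [Nonempty (Fin c)] {ℓ : ℝ → ℝ} {B : ℝ} {v : ScoreVec c} {y : LabelVec c}
    (h : ∀ j, ℓ ((y j : ℝ) * v j) ≤ B) : subsetSurrogate ℓ v y ≤ B :=
  ciSup_le h

lemma subsetLoss_le_subsetSurrogate [Nonempty (Fin c)] {ℓ : ℝ → ℝ} (hℓ : DominatesZeroOne ℓ)
    (v : ScoreVec c) (y : LabelVec c) :
    subsetLoss (fun j => sgn (v j)) y ≤ subsetSurrogate ℓ v y :=
  ciSup_mono (Set.finite_range _).bddAbove fun j => hℓ (v j) (y j)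

lemma subsetLoss_nonneg (h y : LabelVec c) : 0 ≤ subsetLoss h y :=
  Real.iSup_nonneg fun _ => zeroOne_nonneg _ _

lemma subsetLoss_le_one [Nonempty (Fin c)] (h y : LabelVec c) : subsetLoss h y ≤ 1 :=
  ciSup_le fun _ => zeroOne_le_one _ _

lemma hammingLoss_nonneg (h y : LabelVec c) : 0 ≤ hammingLoss h y :=
  mul_nonneg (by positivity) (Finset.sum_nonneg fun _ _ => zeroOne_nonneg _ _)

lemma hammingLoss_le_subsetLoss [Nonempty (Fin c)] (h y : LabelVec c) :
    hammingLoss h y ≤ subsetLoss h y := by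
  have hc : (0 : ℝ) < c := Nat.cast_pos.2 (Fin.pos_iff_nonempty.2 ‹_›)
  have : ∑ j, zeroOne (h j) (y j) ≤ ∑ _j : Fin c, subsetLoss h y :=
    Finset.sum_le_sum fun j _ =>
      le_ciSup (f := fun j => zeroOne (h j) (y j)) (Set.finite_range _).bddAbove j
  rw [Finset.sum_const, Finset.card_univ, Fintype.card_fin, nsmul_eq_mul] at this
  rw [hammingLoss, one_div_mul_eq_div, div_le_iff₀ hc, mul_comm]
  exact this

lemma measurable_sgn : Measurable sgn :=
  Measurable.ite measurableSet_Ioi measurable_const measurable_const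

lemma measurable_zeroOne : Measurable fun p : Label × Label => zeroOne p.1 p.2 :=
  measurable_of_countable _

lemma measurable_zeroOne_sgn {α : Type*} [MeasurableSpace α] {v : α → ScoreVec c}
    {y : α → LabelVec c} (hv : ∀ j, Measurable fun a => v a j) (hy : Measurable y) (j : Fin c) :
    Measurable fun a => zeroOne (sgn (v a j)) (y a j) :=
  measurable_zeroOne.comp ((measurable_sgn.comp (hv j)).prodMk ((measurable_pi_apply j).comp hy))

lemma measurable_subsetLoss_sgn {α : Type*} [MeasurableSpace α] {v : α → ScoreVec c}
    {y : α → LabelVec c} (hv : ∀ j, Measurable fun a => v a j) (hy : Measurable y) :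
    Measurable fun a => subsetLoss (fun j => sgn (v a j)) (y a) :=
  Measurable.iSup fun j => measurable_zeroOne_sgn hv hy j

lemma measurable_hammingLoss_sgn {α : Type*} [MeasurableSpace α] {v : α → ScoreVec c}
    {y : α → LabelVec c} (hv : ∀ j, Measurable fun a => v a j) (hy : Measurable y) :
    Measurable fun a => hammingLoss (fun j => sgn (v a j)) (y a) :=
  (Finset.measurable_sum _ fun j _ => measurable_zeroOne_sgn hv hy j).const_mul _

lemma measurable_subsetSurrogate {α : Type*} [MeasurableSpace α] {ℓ : ℝ → ℝ}
    (hℓ : Measurable ℓ) {v : α → ScoreVec c}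
    {y : α → LabelVec c} (hv : ∀ j, Measurable fun a => v a j) (hy : Measurable y) :
    Measurable fun a => subsetSurrogate ℓ (v a) (y a) :=
  Measurable.iSup fun j => hℓ.comp
    ((measurable_subtype_coe.comp ((measurable_pi_apply j).comp hy)).mul (hv j))

end Losses

/-! ### Measurability and finite-dimensional reduction of the scores -/

section Scores

variable {𝒳 H : Type*} [NormedAddCommGroup H] [InnerProductSpace ℝ H] {c : ℕ}

/-- The score function `x ↦ (⟪W_1, φ x⟫, …, ⟪W_c, φ x⟫)`. -/
def linearScore (φ : 𝒳 → H) (W : PiLp 2 fun _ : Fin c => H) (x : 𝒳) : ScoreVec c :=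
  WithLp.toLp 2 fun j => ⟪W j, φ x⟫_ℝ

@[simp] lemma linearScore_apply (φ : 𝒳 → H) (W : PiLp 2 fun _ : Fin c => H) (x : 𝒳) (j : Fin c) :
    linearScore φ W x j = ⟪W j, φ x⟫_ℝ := rfl

lemma mem_kernelClass_iff {φ : 𝒳 → H} {Λ : ℝ} {f : 𝒳 → ScoreVec c} :
    f ∈ kernelClass c φ Λ ↔ ∃ W : PiLp 2 (fun _ : Fin c => H), ‖W‖ ≤ Λ ∧ f = linearScore φ W := by
  refine exists_congr fun W => and_congr_right fun _ => ⟨fun h => ?_, fun h x j => by rw [h]; rfl⟩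
  ext x j
  exact h x j

/-- Linear functionals of the feature map of a measurable kernel are measurable, because they are
limits of combinations of sections of the kernel. -/
lemma measurable_inner_featureMap [MeasurableSpace 𝒳] [CompleteSpace H] {κ : 𝒳 → 𝒳 → ℝ}
    {φ : 𝒳 → H} (hφ : IsFeatureMap κ φ) (hκm : Measurable (Function.uncurry κ)) (w : H) :
    Measurable fun x => ⟪w, φ x⟫_ℝ := by
  let M : Submodule ℝ H :=
    { carrier := {w | Measurable fun x => ⟪w, φ x⟫_ℝ}
      add_mem' := fun {a b} ha hb => by
        simp only [Set.mem_ofPred_eq, inner_add_left] at *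
        exact ha.add hb
      zero_mem' := by simp
      smul_mem' := fun r a ha => by
        simp only [Set.mem_ofPred_eq, real_inner_smul_left] at *
        exact ha.const_mul r }
  have hspan : Submodule.span ℝ (Set.range φ) ≤ M := by
    refine Submodule.span_le.2 ?_
    rintro _ ⟨x', rfl⟩
    change Measurable fun x => ⟪φ x', φ x⟫_ℝ
    simp only [← hφ x']
    exact hκm.comp measurable_prodMk_left
  -- Only the kernel is known to be measurable, not `φ`. Projecting `w` onto the closed span of the
  -- features changes no score and yields a limit of a sequence from that span.
  let K := (Submodule.span ℝ (Set.range φ)).topologicalClosure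
  have hK : ∀ u ∈ K, Measurable fun x => ⟪u, φ x⟫_ℝ := by
    intro u hu
    obtain ⟨s, hs, hlim⟩ := mem_closure_iff_seq_limit.1 hu
    refine measurable_of_tendsto_metrizable (f := fun k x => ⟪s k, φ x⟫_ℝ)
      (fun k => hspan (hs k)) ?_
    exact tendsto_pi_nhds.2 fun x => hlim.inner tendsto_const_nhds
  have : CompleteSpace K := (Submodule.isClosed_topologicalClosure _).completeSpace_coe
  have hproj : ∀ x, ⟪w, φ x⟫_ℝ = ⟪K.starProjection w, φ x⟫_ℝ := by
    intro x
    have hx : φ x ∈ K := Submodule.le_topologicalClosure _ (Submodule.subset_span ⟨x, rfl⟩)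
    have := Submodule.starProjection_inner_eq_zero w (φ x) hx
    rw [inner_sub_left] at this
    linarith
  simp only [hproj]
  exact hK _ (Submodule.starProjection_apply_mem _ _)

/-- Rescaling of a vector to the ball of radius `Λ`. -/
noncomputable def clip {E : Type*} [NormedAddCommGroup E] [NormedSpace ℝ E] (Λ : ℝ) (W : E) : E :=
  (Λ / max Λ ‖W‖) • W

lemma norm_clip_le {E : Type*} [NormedAddCommGroup E] [NormedSpace ℝ E] {Λ : ℝ} (hΛ : 0 ≤ Λ)
    (W : E) : ‖clip Λ W‖ ≤ Λ := by
  rw [clip, norm_smul, Real.norm_of_nonneg (by positivity), div_mul_eq_mul_div]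
  exact div_le_of_le_mul₀ (by positivity) hΛ (by gcongr; exact le_max_right _ _)

lemma clip_eq_self {E : Type*} [NormedAddCommGroup E] [NormedSpace ℝ E] {Λ : ℝ}
    {W : E} (hW : ‖W‖ ≤ Λ) : clip Λ W = W := by
  rw [clip, max_eq_left hW]
  rcases eq_or_ne Λ 0 with rfl | h
  · simp [norm_le_zero_iff.1 hW]
  · rw [div_self h, one_smul]

lemma continuous_clip {E : Type*} [NormedAddCommGroup E] [NormedSpace ℝ E] {Λ : ℝ} (hΛ : 0 ≤ Λ) :
    Continuous (clip Λ : E → E) := by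
  -- At radius zero the denominator can vanish, but the numerator is zero and the map is constant.
  rcases hΛ.eq_or_lt with rfl | h
  · have : (clip 0 : E → E) = fun _ => 0 := by ext; simp [clip]
    rw [this]
    exact continuous_const
  · exact (continuous_const.div (continuous_const.max continuous_norm)
      fun W => (lt_max_of_lt_left h).ne').smul continuous_id

lemma measurable_kernel_eval {ι : Type*} [MeasurableSpace 𝒳] {κ : 𝒳 → 𝒳 → ℝ}
    (hκm : Measurable (Function.uncurry κ)) (k l : ι) :
    Measurable fun x : ι → 𝒳 => κ (x k) (x l) := by
  have h : Measurable fun x : ι → 𝒳 => (x k, x l) := by fun_prop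
  exact hκm.comp h

variable {ι : Type*} [Fintype ι]

/-- The weight vectors `∑ k, A_{kj} φ(x_k)`. -/
noncomputable def featureCombination (φ : 𝒳 → H) (x : ι → 𝒳) (A : ι → Fin c → ℝ) :
    PiLp 2 fun _ : Fin c => H :=
  WithLp.toLp 2 fun j => ∑ k, A k j • φ (x k)

lemma continuous_featureCombination (φ : 𝒳 → H) (x : ι → 𝒳) :
    Continuous (featureCombination (c := c) φ x) := by
  unfold featureCombination
  fun_prop

/-- A finite-dimensional representer theorem. -/
lemma exists_featureCombination (φ : 𝒳 → H) (x : ι → 𝒳) (W : PiLp 2 fun _ : Fin c => H) :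
    ∃ A : ι → Fin c → ℝ, ‖featureCombination φ x A‖ ≤ ‖W‖ ∧
      ∀ i, linearScore φ (featureCombination φ x A) (x i) = linearScore φ W (x i) := by
  -- Projecting each weight onto the span of the sampled features does not increase its norm and
  -- preserves its inner products with those features.
  let K := Submodule.span ℝ (Set.range fun k => φ (x k))
  have : FiniteDimensional ℝ K := FiniteDimensional.span_of_finite ℝ (Set.finite_range _)
  have hA : ∀ j, ∃ a : ι → ℝ, ∑ k, a k • φ (x k) = K.starProjection (W j) := fun j =>
    (Submodule.mem_span_range_iff_exists_fun ℝ).1 (Submodule.starProjection_apply_mem K (W j))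
  choose a ha using hA
  have hval : ∀ j, featureCombination φ x (fun k j => a j k) j = K.starProjection (W j) := ha
  refine ⟨fun k j => a j k, ?_, fun i => ?_⟩
  · rw [PiLp.norm_eq_of_L2, PiLp.norm_eq_of_L2]
    refine Real.sqrt_le_sqrt (Finset.sum_le_sum fun j _ => ?_)
    rw [hval]
    gcongr
    exact Submodule.norm_starProjection_apply_le K (W j)
  · ext j
    have hx : φ (x i) ∈ K := Submodule.subset_span ⟨i, rfl⟩
    have := Submodule.starProjection_inner_eq_zero (W j) (φ (x i)) hx
    rw [linearScore_apply, linearScore_apply, hval]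
    rw [inner_sub_left] at this
    linarith

/-- The squared norm is a Gram expression in kernel values, so no measurability of `φ` is required.
-/
lemma measurable_norm_featureCombination [MeasurableSpace 𝒳] {κ : 𝒳 → 𝒳 → ℝ}
    {φ : 𝒳 → H} (hφ : IsFeatureMap κ φ) (hκm : Measurable (Function.uncurry κ))
    (A : ι → Fin c → ℝ) : Measurable fun x : ι → 𝒳 => ‖featureCombination φ x A‖ := by
  have : ∀ x : ι → 𝒳, ‖featureCombination φ x A‖ =
      √(∑ j, ∑ k, ∑ l, A k j * (A l j * κ (x k) (x l))) := by
    intro x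
    rw [PiLp.norm_eq_of_L2]
    congr 1
    refine Finset.sum_congr rfl fun j _ => ?_
    rw [← real_inner_self_eq_norm_sq]
    simp only [featureCombination, sum_inner, inner_sum, real_inner_smul_left,
      real_inner_smul_right, hφ _ _]
    exact Finset.sum_congr rfl fun k _ => Finset.sum_congr rfl fun l _ => by
      rw [real_inner_comm]
  simp only [this]
  refine Measurable.sqrt ?_
  refine Finset.measurable_sum _ fun j _ => Finset.measurable_sum _ fun k _ =>
    Finset.measurable_sum _ fun l _ => ?_
  exact ((measurable_kernel_eval hκm k l).const_mul _).const_mul _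

lemma measurable_linearScore_clip_featureCombination [MeasurableSpace 𝒳] {κ : 𝒳 → 𝒳 → ℝ}
    {φ : 𝒳 → H} (hφ : IsFeatureMap κ φ) (hκm : Measurable (Function.uncurry κ)) (Λ : ℝ)
    (A : ι → Fin c → ℝ) (i : ι) (j : Fin c) :
    Measurable fun x : ι → 𝒳 => linearScore φ (clip Λ (featureCombination φ x A)) (x i) j := by
  have : ∀ x : ι → 𝒳, linearScore φ (clip Λ (featureCombination φ x A)) (x i) j =
      (Λ / max Λ ‖featureCombination φ x A‖) * ∑ k, A k j * κ (x k) (x i) := by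
    intro x
    rw [linearScore_apply, clip, PiLp.smul_apply, real_inner_smul_left]
    simp only [featureCombination, sum_inner, real_inner_smul_left, hφ _ _]
  simp only [this]
  refine ((measurable_const.max (measurable_norm_featureCombination hφ hκm A)).const_div Λ).mul
    (Finset.measurable_sum _ fun k _ => ?_)
  exact (measurable_kernel_eval hκm k i).const_mul _

lemma continuous_linearScore (φ : 𝒳 → H) (x : 𝒳) :
    Continuous fun W : PiLp 2 (fun _ : Fin c => H) => linearScore φ W x := by
  unfold linearScore
  fun_prop

end Scores

lemma sq_expect_le_expect_sq {ι : Type*} [Fintype ι] [Nonempty ι] (f : ι → ℝ) :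
    (𝔼 i, f i) ^ 2 ≤ 𝔼 i, f i ^ 2 := by
  have hc : (0 : ℝ) < Fintype.card ι := Nat.cast_pos.2 Fintype.card_pos
  have := sq_sum_le_card_mul_sum_sq (s := (Finset.univ : Finset ι)) (f := f)
  rw [Fintype.expect_eq_sum_div_card, Fintype.expect_eq_sum_div_card, div_pow,
    div_le_div_iff₀ (by positivity) hc]
  rw [Finset.card_univ] at this
  nlinarith

/-! ### Rademacher bound and exponential symmetrization on a double sample -/

section RiskGap

variable {𝒳 H : Type*} [NormedAddCommGroup H] [InnerProductSpace ℝ H] {c n : ℕ}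

/-- The Rademacher average of a class of losses which are Lipschitz, in the sup norm, in the scores
of the kernel class. -/
lemma expect_sum_boolSign_mul_le {κ : 𝒳 → 𝒳 → ℝ} {φ : 𝒳 → H} (hφ : IsFeatureMap κ φ) {r Λ : ℝ}
    (hκr : ∀ x, κ x x ≤ r ^ 2) (hΛ : 0 ≤ Λ) (ρ : ℝ≥0) (x : Fin n → 𝒳)
    (ψ : Fin n → Metric.closedBall (0 : PiLp 2 fun _ : Fin c => H) Λ → ℝ)
    (hψ : ∀ i s t, ∃ j, |ψ i s - ψ i t| ≤
      ρ * |linearScore φ s.1 (x i) j - linearScore φ t.1 (x i) j|)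
    (t : (Fin n → Bool) → Metric.closedBall (0 : PiLp 2 fun _ : Fin c => H) Λ) :
    𝔼 σ, ∑ i, boolSign (σ i) * ψ i (t σ) ≤ ρ * (Λ * √(c * (n * r ^ 2))) := by
  obtain ⟨τ, hτ⟩ := exists_contraction n (fun _ => 0) ψ
    (fun i j W => linearScore φ W.1 (x i) j) hψ t
  simp only [zero_add] at hτ
  refine hτ.trans ?_
  rw [← Finset.mul_expect]
  refine mul_le_mul_of_nonneg_left ?_ ρ.2
  let V : (Fin n → Fin c → Bool) → PiLp 2 fun _ : Fin c => H := fun ε =>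
    featureCombination φ x fun i k => boolSign (ε i k)
  have h1 : ∀ ε, ∑ i, ∑ k, boolSign (ε i k) * linearScore φ (τ ε).1 (x i) k ≤ Λ * ‖V ε‖ := by
    intro ε
    -- Linearity collects the signed scores into one pairing with a random vector independent of the
    -- selected weights.
    have : ∑ i, ∑ k, boolSign (ε i k) * linearScore φ (τ ε).1 (x i) k = ⟪(τ ε).1, V ε⟫_ℝ := by
      rw [PiLp.inner_apply, Finset.sum_comm]
      simp [V, featureCombination, inner_sum, real_inner_smul_right]
    rw [this]
    refine (real_inner_le_norm _ _).trans ?_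
    gcongr
    exact mem_closedBall_zero_iff.1 (τ ε).2
  have h2 : 𝔼 ε, ‖V ε‖ ^ 2 ≤ c * (n * r ^ 2) := by
    calc 𝔼 ε, ‖V ε‖ ^ 2
        = ∑ j, 𝔼 ε : Fin n → Fin c → Bool, ‖0 + ∑ i, boolSign (ε i j) • φ (x i)‖ ^ 2 := by
          rw [← Finset.expect_sum_comm]
          refine Finset.expect_congr rfl fun ε _ => ?_
          rw [PiLp.norm_sq_eq_of_L2]
          simp [V, featureCombination]
      _ = ∑ _j : Fin c, ∑ i, κ (x i) (x i) := by
          refine Finset.sum_congr rfl fun j _ => ?_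
          rw [expect_norm_add_sum_boolSign_smul_sq]
          simp [hφ _ _]
      _ ≤ ∑ _j : Fin c, ∑ _i : Fin n, r ^ 2 := by
          gcongr
          exact hκr _
      _ = _ := by simp
  calc _ ≤ 𝔼 ε, Λ * ‖V ε‖ := Finset.expect_le_expect fun ε _ => h1 ε
    _ = Λ * 𝔼 ε, ‖V ε‖ := (Finset.mul_expect ..).symm
    _ ≤ _ := by
      gcongr
      exact Real.le_sqrt_of_sq_le ((sq_expect_le_expect_sq _).trans h2)

/-- The surrogate subset loss of the weights `W` on an example. -/
noncomputable def surrogateLoss (φ : 𝒳 → H) (ℓ : ℝ → ℝ) (W : PiLp 2 fun _ : Fin c => H)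
    (z : 𝒳 × LabelVec c) : ℝ :=
  subsetSurrogate ℓ (linearScore φ W z.1) z.2

/-- The empirical risk on the right half of a double sample, minus that on the left half. -/
noncomputable def riskGap (φ : 𝒳 → H) (ℓ : ℝ → ℝ) (W : PiLp 2 fun _ : Fin c => H)
    (S : Fin n ⊕ Fin n → 𝒳 × LabelVec c) : ℝ :=
  (1 / (n : ℝ)) * ∑ i, (surrogateLoss φ ℓ W (S (.inr i)) - surrogateLoss φ ℓ W (S (.inl i)))

/-- The gap after swapping the two halves wherever the sign is negative. -/
noncomputable def signedGap (φ : 𝒳 → H) (ℓ : ℝ → ℝ) (S : Fin n ⊕ Fin n → 𝒳 × LabelVec c)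
    (σ : Fin n → Bool) (W : PiLp 2 fun _ : Fin c => H) : ℝ :=
  (1 / (n : ℝ)) * ∑ i, boolSign (σ i) *
    (surrogateLoss φ ℓ W (S (.inr i)) - surrogateLoss φ ℓ W (S (.inl i)))

lemma expect_iSup_signedGap_le [Nonempty (Fin c)] {κ : 𝒳 → 𝒳 → ℝ} {φ : 𝒳 → H}
    (hφ : IsFeatureMap κ φ) {r Λ : ℝ}
    (hκr : ∀ x, κ x x ≤ r ^ 2) (hΛ : 0 ≤ Λ) {ℓ : ℝ → ℝ} {ρ : ℝ≥0} (hρ : LipschitzWith ρ ℓ)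
    (S : Fin n ⊕ Fin n → 𝒳 × LabelVec c) :
    𝔼 σ, (⨆ W : Metric.closedBall (0 : PiLp 2 fun _ : Fin c => H) Λ, signedGap φ ℓ S σ W.1) ≤
      (1 / (n : ℝ)) * (2 * (ρ * (Λ * √(c * (n * r ^ 2))))) := by
  have : Nonempty (Metric.closedBall (0 : PiLp 2 fun _ : Fin c => H) Λ) :=
    ⟨⟨0, by simpa using hΛ⟩⟩
  refine le_of_forall_pos_le_add fun e he => ?_
  -- The supremum may not be attained, so near-maximizers are selected for each sign pattern. The
  -- contraction principle is stated for such selections.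
  have hsel := fun σ : Fin n → Bool => exists_lt_of_lt_ciSup (sub_lt_self
    (⨆ W : Metric.closedBall (0 : PiLp 2 fun _ : Fin c => H) Λ, signedGap φ ℓ S σ W.1) he)
  choose t ht using hsel
  have hr := expect_sum_boolSign_mul_le hφ hκr hΛ ρ (fun i => (S (.inr i)).1)
    (fun i W => surrogateLoss φ ℓ W.1 (S (.inr i)))
    (fun i s t => exists_abs_subsetSurrogate_sub_le hρ _ _ _) t
  have hl := expect_sum_boolSign_mul_le hφ hκr hΛ ρ (fun i => (S (.inl i)).1)
    (fun i W => -surrogateLoss φ ℓ W.1 (S (.inl i)))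
    (fun i s t => by
      obtain ⟨j, hj⟩ := exists_abs_subsetSurrogate_sub_le hρ
        (linearScore φ s.1 (S (.inl i)).1) (linearScore φ t.1 (S (.inl i)).1) (S (.inl i)).2
      refine ⟨j, ?_⟩
      rw [← abs_neg]
      convert hj using 2
      simp only [surrogateLoss]
      ring) t
  calc _ ≤ 𝔼 σ, (signedGap φ ℓ S σ (t σ).1 + e) :=
        Finset.expect_le_expect fun σ _ => by linarith [ht σ]
    _ = (1 / (n : ℝ)) * (𝔼 σ, ∑ i, boolSign (σ i) * surrogateLoss φ ℓ (t σ).1 (S (.inr i)) +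
          𝔼 σ, ∑ i, boolSign (σ i) * -surrogateLoss φ ℓ (t σ).1 (S (.inl i))) + e := by
        rw [Finset.expect_add_distrib, Finset.expect_const Finset.univ_nonempty,
          ← Finset.expect_add_distrib, Finset.mul_expect]
        congr 1
        refine Finset.expect_congr rfl fun σ _ => ?_
        rw [signedGap, ← Finset.sum_add_distrib]
        congr 1
        refine Finset.sum_congr rfl fun i _ => ?_
        ring
    _ ≤ _ := by
        gcongr
        linarith

lemma abs_sub_le_of_mem_Icc {a b B : ℝ} (ha : a ∈ Set.Icc 0 B) (hb : b ∈ Set.Icc 0 B) :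
    |a - b| ≤ B :=
  abs_sub_le_iff.2 ⟨by linarith [ha.2, hb.1], by linarith [ha.1, hb.2]⟩

lemma bddAbove_signedGap {φ : 𝒳 → H} {ℓ : ℝ → ℝ} {Λ B : ℝ}
    (hB : ∀ W : PiLp 2 (fun _ : Fin c => H), ‖W‖ ≤ Λ → ∀ z, surrogateLoss φ ℓ W z ∈ Set.Icc 0 B)
    (S : Fin n ⊕ Fin n → 𝒳 × LabelVec c) (σ : Fin n → Bool) :
    BddAbove (Set.range fun W : Metric.closedBall (0 : PiLp 2 fun _ : Fin c => H) Λ =>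
      signedGap φ ℓ S σ W.1) := by
  refine ⟨(1 / (n : ℝ)) * ∑ _i : Fin n, B, ?_⟩
  rintro _ ⟨W, rfl⟩
  refine mul_le_mul_of_nonneg_left (Finset.sum_le_sum fun i _ => ?_) (by positivity)
  have hW := mem_closedBall_zero_iff.1 W.2
  have := abs_sub_le_of_mem_Icc (hB W hW (S (.inr i))) (hB W hW (S (.inl i)))
  refine le_trans ?_ this
  cases σ i <;> simp only [boolSign, if_true, Bool.false_eq_true, if_false] <;>
    linarith [le_abs_self (surrogateLoss φ ℓ W.1 (S (.inr i)) -
      surrogateLoss φ ℓ W.1 (S (.inl i))), neg_abs_le (surrogateLoss φ ℓ W.1 (S (.inr i)) -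
      surrogateLoss φ ℓ W.1 (S (.inl i)))]

lemma expect_exp_iSup_signedGap_le [Nonempty (Fin c)] {κ : 𝒳 → 𝒳 → ℝ} {φ : 𝒳 → H}
    (hφ : IsFeatureMap κ φ) {r Λ B : ℝ}
    (hκr : ∀ x, κ x x ≤ r ^ 2) (hΛ : 0 ≤ Λ) {ℓ : ℝ → ℝ} {ρ : ℝ≥0} (hρ : LipschitzWith ρ ℓ)
    (hB : ∀ W : PiLp 2 (fun _ : Fin c => H), ‖W‖ ≤ Λ → ∀ z, surrogateLoss φ ℓ W z ∈ Set.Icc 0 B)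
    (S : Fin n ⊕ Fin n → 𝒳 × LabelVec c) {l : ℝ} (hl : 0 ≤ l) :
    𝔼 σ, Real.exp (l * ⨆ W : Metric.closedBall (0 : PiLp 2 fun _ : Fin c => H) Λ,
        signedGap φ ℓ S σ W.1) ≤
      Real.exp (l * ((1 / (n : ℝ)) * (2 * (ρ * (Λ * √(c * (n * r ^ 2)))))) +
        n * (l * (2 * B / n)) ^ 2 / 8) := by
  have : Nonempty (Metric.closedBall (0 : PiLp 2 fun _ : Fin c => H) Λ) :=
    ⟨⟨0, by simpa using hΛ⟩⟩
  -- Flipping one sign reverses a single loss difference, which lies in `[-B, B]`; the normalized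
  -- sum moves by at most `2 * B / n`.
  refine (expect_exp_le_of_bounded_differences n l (2 * B / n) _ fun σ i b => ?_).trans ?_
  · refine ciSup_le fun W => ?_
    refine le_trans ?_ (add_le_add_left (le_ciSup (bddAbove_signedGap hB S σ) W) _)
    rw [← sub_le_iff_le_add']
    have hW := mem_closedBall_zero_iff.1 W.2
    have hD := abs_le.1 (abs_sub_le_of_mem_Icc (hB W hW (S (.inr i))) (hB W hW (S (.inl i))))
    rw [signedGap, signedGap, ← mul_sub, ← Finset.sum_sub_distrib, Finset.sum_eq_single i]
    · rw [Function.update_self, one_div_mul_eq_div]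
      gcongr
      cases b <;> cases σ i <;> simp only [boolSign, if_true, Bool.false_eq_true, if_false] <;>
        linarith [hD.1, hD.2]
    · intro k _ hk
      rw [Function.update_of_ne hk, sub_self]
    · simp
  · gcongr
    exact expect_iSup_signedGap_le hφ hκr hΛ hρ S

/-- The exponential of the largest gap over the ball of radius `Λ`, written as a supremum over the
countably many rescaled rational combinations of the features of the sample. -/
noncomputable def expGapSup (φ : 𝒳 → H) (ℓ : ℝ → ℝ) (Λ l : ℝ)
    (S : Fin n ⊕ Fin n → 𝒳 × LabelVec c) : ENNReal :=
  ⨆ A : Fin n ⊕ Fin n → Fin c → ℚ, ENNReal.ofReal (Real.exp (l * riskGap φ ℓ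
    (clip Λ (featureCombination φ (fun k => (S k).1) fun k j => (A k j : ℝ))) S))

lemma measurable_expGapSup [MeasurableSpace 𝒳] {κ : 𝒳 → 𝒳 → ℝ} {φ : 𝒳 → H}
    (hφ : IsFeatureMap κ φ) (hκm : Measurable (Function.uncurry κ)) {ℓ : ℝ → ℝ}
    (hℓ : Measurable ℓ) (Λ l : ℝ) :
    Measurable (expGapSup φ ℓ Λ l : (Fin n ⊕ Fin n → 𝒳 × LabelVec c) → ENNReal) := by
  refine Measurable.iSup fun A => ?_
  have h : ∀ i, Measurable fun S : Fin n ⊕ Fin n → 𝒳 × LabelVec c => surrogateLoss φ ℓ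
      (clip Λ (featureCombination φ (fun k => (S k).1) fun k j => (A k j : ℝ))) (S i) := by
    intro i
    have hx : Measurable fun (S : Fin n ⊕ Fin n → 𝒳 × LabelVec c) k => (S k).1 := by fun_prop
    refine measurable_subsetSurrogate hℓ (fun j => ?_) (by fun_prop)
    exact (measurable_linearScore_clip_featureCombination hφ hκm Λ
      (fun k j => (A k j : ℝ)) i j).comp hx
  refine ENNReal.measurable_ofReal.comp (Real.measurable_exp.comp (Measurable.const_mul ?_ l))
  exact (Finset.measurable_sum _ fun i _ => (h _).sub (h _)).const_mul _

/-- The countable supremum loses nothing: the gap sees `W` only through sampled scores, `clip` is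
the identity on the ball, and rational coefficients are dense. -/
lemma ofReal_exp_riskGap_le_expGapSup [Nonempty (Fin c)] (φ : 𝒳 → H) {ℓ : ℝ → ℝ} {ρ : ℝ≥0}
    (hρ : LipschitzWith ρ ℓ) {Λ : ℝ} (l : ℝ) {W : PiLp 2 fun _ : Fin c => H} (hW : ‖W‖ ≤ Λ)
    (S : Fin n ⊕ Fin n → 𝒳 × LabelVec c) :
    ENNReal.ofReal (Real.exp (l * riskGap φ ℓ W S)) ≤ expGapSup φ ℓ Λ l S := by
  have hΛ : 0 ≤ Λ := (norm_nonneg _).trans hW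
  let x : Fin n ⊕ Fin n → 𝒳 := fun k => (S k).1
  let g : (Fin n ⊕ Fin n → Fin c → ℝ) → ENNReal := fun A =>
    ENNReal.ofReal (Real.exp (l * riskGap φ ℓ (clip Λ (featureCombination φ x A)) S))
  have hg : Continuous g := by
    have h : ∀ i, Continuous fun A : Fin n ⊕ Fin n → Fin c → ℝ =>
        surrogateLoss φ ℓ (clip Λ (featureCombination φ x A)) (S i) := fun i =>
      (lipschitzWith_subsetSurrogate hρ (S i).2).continuous.comp
        ((continuous_linearScore φ (S i).1).comp
          ((continuous_clip hΛ).comp (continuous_featureCombination φ x)))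
    refine ENNReal.continuous_ofReal.comp (Real.continuous_exp.comp (continuous_const.mul ?_))
    exact continuous_const.mul (continuous_finsetSum _ fun i _ => (h _).sub (h _))
  have hdense : DenseRange fun (A : Fin n ⊕ Fin n → Fin c → ℚ) k j => (A k j : ℝ) :=
    DenseRange.piMap fun _ => DenseRange.piMap fun _ => Rat.denseRange_cast
  have hall : ∀ A, g A ≤ expGapSup φ ℓ Λ l S := fun A =>
    hdense.induction_on A (isClosed_le hg continuous_const) fun A =>
      le_iSup (fun A : Fin n ⊕ Fin n → Fin c → ℚ => g fun k j => (A k j : ℝ)) A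
  obtain ⟨A, hA, hval⟩ := exists_featureCombination φ x W
  have hgap : riskGap φ ℓ W S = riskGap φ ℓ (clip Λ (featureCombination φ x A)) S := by
    rw [clip_eq_self (hA.trans hW)]
    simp only [riskGap, surrogateLoss]
    congr 1
    refine Finset.sum_congr rfl fun i _ => ?_
    rw [← hval (.inr i), ← hval (.inl i)]
  rw [hgap]
  exact hall A

/-- Swap the two copies of `i` when `σ i` is false. -/
def swapCopies (σ : Fin n → Bool) : Fin n ⊕ Fin n → Fin n ⊕ Fin n :=
  Sum.elim (fun i => if σ i then .inl i else .inr i) (fun i => if σ i then .inr i else .inl i)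

lemma swapCopies_involutive (σ : Fin n → Bool) : Function.Involutive (swapCopies σ) := by
  rintro (i | i) <;> by_cases h : σ i <;> simp [swapCopies, h]

lemma riskGap_swapCopies (φ : 𝒳 → H) (ℓ : ℝ → ℝ) (W : PiLp 2 fun _ : Fin c => H)
    (S : Fin n ⊕ Fin n → 𝒳 × LabelVec c) (σ : Fin n → Bool) :
    riskGap φ ℓ W (fun k => S (swapCopies σ k)) = signedGap φ ℓ S σ W := by
  unfold riskGap signedGap
  congr 1
  refine Finset.sum_congr rfl fun i _ => ?_
  by_cases h : σ i <;> simp [swapCopies, h, boolSign]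

lemma measurePreserving_comp_involutive {ι Z : Type*} [Fintype ι] [MeasurableSpace Z]
    (D : Measure Z) [SigmaFinite D] {e : ι → ι} (he : Function.Involutive e) :
    MeasurePreserving (fun (S : ι → Z) k => S (e k)) (Measure.pi fun _ => D)
      (Measure.pi fun _ => D) :=
  measurePreserving_arrowCongr' (fun _ => D) (fun _ => D) he.toPerm (MeasurableEquiv.refl Z)
    fun _ => MeasurePreserving.id D

lemma expGapSup_swapCopies_le {φ : 𝒳 → H} {ℓ : ℝ → ℝ} {Λ B l : ℝ} (hΛ : 0 ≤ Λ) (hl : 0 ≤ l)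
    (hB : ∀ W : PiLp 2 (fun _ : Fin c => H), ‖W‖ ≤ Λ → ∀ z, surrogateLoss φ ℓ W z ∈ Set.Icc 0 B)
    (S : Fin n ⊕ Fin n → 𝒳 × LabelVec c) (σ : Fin n → Bool) :
    expGapSup φ ℓ Λ l (fun k => S (swapCopies σ k)) ≤
      ENNReal.ofReal (Real.exp (l *
        ⨆ W : Metric.closedBall (0 : PiLp 2 fun _ : Fin c => H) Λ, signedGap φ ℓ S σ W.1)) := by
  refine iSup_le fun A => ?_
  rw [riskGap_swapCopies]
  gcongr
  exact le_ciSup (bddAbove_signedGap hB S σ) ⟨_, mem_closedBall_zero_iff.2 (norm_clip_le hΛ _)⟩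

/-- Exponential symmetrization. -/
lemma lintegral_expGapSup_le [MeasurableSpace 𝒳] [Nonempty (Fin c)] {κ : 𝒳 → 𝒳 → ℝ} {φ : 𝒳 → H}
    (hφ : IsFeatureMap κ φ) (hκm : Measurable (Function.uncurry κ)) {r Λ B : ℝ}
    (hκr : ∀ x, κ x x ≤ r ^ 2) (hΛ : 0 ≤ Λ) {ℓ : ℝ → ℝ} {ρ : ℝ≥0} (hρ : LipschitzWith ρ ℓ)
    (hB : ∀ W : PiLp 2 (fun _ : Fin c => H), ‖W‖ ≤ Λ → ∀ z, surrogateLoss φ ℓ W z ∈ Set.Icc 0 B)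
    (D : Measure (𝒳 × LabelVec c)) [IsProbabilityMeasure D] {l : ℝ} (hl : 0 ≤ l) :
    ∫⁻ S, expGapSup φ ℓ Λ l S ∂(Measure.pi fun _ : Fin n ⊕ Fin n => D) ≤
      ENNReal.ofReal (Real.exp (l * ((1 / (n : ℝ)) * (2 * (ρ * (Λ * √(c * (n * r ^ 2)))))) +
        n * (l * (2 * B / n)) ^ 2 / 8)) := by
  set C := Real.exp (l * ((1 / (n : ℝ)) * (2 * (ρ * (Λ * √(c * (n * r ^ 2)))))) +
        n * (l * (2 * B / n)) ^ 2 / 8)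
  have hm : Measurable (expGapSup φ ℓ Λ l : (Fin n ⊕ Fin n → 𝒳 × LabelVec c) → ENNReal) :=
    measurable_expGapSup hφ hκm hρ.continuous.measurable Λ l
  have hmp := fun σ : Fin n → Bool => measurePreserving_comp_involutive D (swapCopies_involutive σ)
  let N : ENNReal := Fintype.card (Fin n → Bool)
  have hN : N ≠ 0 := by simp [N]
  have hN' : N ≠ ⊤ := ENNReal.natCast_ne_top _
  -- Every swap preserves the product measure, so `N` copies of the integral equal the sum over all
  -- sign patterns, which is then bounded for each fixed `S`.
  refine (ENNReal.mul_le_mul_iff_right hN hN').1 ?_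
  calc N * ∫⁻ S, expGapSup φ ℓ Λ l S ∂(Measure.pi fun _ : Fin n ⊕ Fin n => D)
      = ∑ σ : Fin n → Bool, ∫⁻ S, expGapSup φ ℓ Λ l (fun k => S (swapCopies σ k))
          ∂(Measure.pi fun _ : Fin n ⊕ Fin n => D) := by
        simp only [(hmp _).lintegral_comp hm, Finset.sum_const, nsmul_eq_mul, Finset.card_univ, N]
    _ = ∫⁻ S, ∑ σ : Fin n → Bool, expGapSup φ ℓ Λ l (fun k => S (swapCopies σ k))
          ∂(Measure.pi fun _ : Fin n ⊕ Fin n => D) :=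
        (lintegral_finsetSum _ fun σ _ => hm.comp (hmp σ).measurable).symm
    _ ≤ ∫⁻ _S, N * ENNReal.ofReal C ∂(Measure.pi fun _ : Fin n ⊕ Fin n => D) := by
        refine lintegral_mono fun S => ?_
        refine (Finset.sum_le_sum fun σ _ => expGapSup_swapCopies_le hΛ hl hB S σ).trans ?_
        rw [← ENNReal.ofReal_sum_of_nonneg fun _ _ => (Real.exp_pos _).le]
        have hNr : N = ENNReal.ofReal (Fintype.card (Fin n → Bool) : ℝ) :=
          (ENNReal.ofReal_natCast _).symm
        rw [hNr, ← ENNReal.ofReal_mul (Nat.cast_nonneg _)]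
        refine ENNReal.ofReal_le_ofReal ?_
        have h := expect_exp_iSup_signedGap_le hφ hκr hΛ hρ hB S hl
        rw [Fintype.expect_eq_sum_div_card, div_le_iff₀ (Nat.cast_pos.2 Fintype.card_pos)] at h
        rwa [mul_comm]
    _ = N * ENNReal.ofReal C := by simp

end RiskGap

/-! ### Ghost sample, Markov's inequality and constants -/

section Risk

variable {𝒳 H : Type*} [MeasurableSpace 𝒳] [NormedAddCommGroup H] [InnerProductSpace ℝ H]
  {c n : ℕ}

lemma measurable_surrogateLoss [CompleteSpace H] {κ : 𝒳 → 𝒳 → ℝ} {φ : 𝒳 → H}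
    (hφ : IsFeatureMap κ φ) (hκm : Measurable (Function.uncurry κ)) {ℓ : ℝ → ℝ}
    (hℓ : Measurable ℓ) (W : PiLp 2 fun _ : Fin c => H) : Measurable (surrogateLoss φ ℓ W) :=
  measurable_subsetSurrogate hℓ
    (fun j => (measurable_inner_featureMap hφ hκm (W j)).comp measurable_fst) measurable_snd

lemma integrable_of_mem_Icc {α : Type*} [MeasurableSpace α] {μ : Measure α} [IsFiniteMeasure μ]
    {f : α → ℝ} (hf : Measurable f) {B : ℝ} (hB : ∀ a, f a ∈ Set.Icc 0 B) : Integrable f μ :=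
  Integrable.of_bound hf.aestronglyMeasurable B (ae_of_all _ fun a => by
    rw [Real.norm_of_nonneg (hB a).1]
    exact (hB a).2)

lemma integral_average_pi {Z : Type*} [MeasurableSpace Z] (hn : 1 ≤ n) (D : Measure Z)
    [IsProbabilityMeasure D] {f : Z → ℝ} (hf : Integrable f D) :
    ∫ S, (1 / (n : ℝ)) * ∑ i, f (S i) ∂(Measure.pi fun _ : Fin n => D) = ∫ z, f z ∂D := by
  have hn' : (n : ℝ) ≠ 0 := by positivity
  have hmp := fun i => measurePreserving_eval (fun _ : Fin n => D) i
  have hi : ∀ i, Integrable (fun S : Fin n → Z => f (S i)) (Measure.pi fun _ : Fin n => D) :=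
    fun i => (hmp i).integrable_comp_of_integrable hf
  have he : ∀ i, ∫ S, f (S i) ∂(Measure.pi fun _ : Fin n => D) = ∫ z, f z ∂D := by
    intro i
    have h := integral_map (hmp i).measurable.aemeasurable (f := f)
      ((hmp i).map_eq.symm ▸ hf.aestronglyMeasurable)
    rw [(hmp i).map_eq] at h
    exact h.symm
  rw [integral_const_mul, integral_finsetSum _ fun i _ => hi i]
  simp only [he, Finset.sum_const, Finset.card_univ, Fintype.card_fin, nsmul_eq_mul]
  field_simp

/-- The exponential of the deviation of the risk is at most the average, over a ghost sample, of
the largest exponential gap. -/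
lemma ofReal_exp_deviation_le [CompleteSpace H] [Nonempty (Fin c)] (hn : 1 ≤ n) {κ : 𝒳 → 𝒳 → ℝ}
    {φ : 𝒳 → H} (hφ : IsFeatureMap κ φ) (hκm : Measurable (Function.uncurry κ)) {Λ B : ℝ}
    {ℓ : ℝ → ℝ} {ρ : ℝ≥0} (hρ : LipschitzWith ρ ℓ)
    (hB : ∀ W : PiLp 2 (fun _ : Fin c => H), ‖W‖ ≤ Λ → ∀ z, surrogateLoss φ ℓ W z ∈ Set.Icc 0 B)
    (D : Measure (𝒳 × LabelVec c)) [IsProbabilityMeasure D] (l : ℝ)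
    {W : PiLp 2 fun _ : Fin c => H} (hW : ‖W‖ ≤ Λ) (S : Fin n → 𝒳 × LabelVec c) :
    ENNReal.ofReal (Real.exp (l * (∫ z, surrogateLoss φ ℓ W z ∂D -
        (1 / (n : ℝ)) * ∑ i, surrogateLoss φ ℓ W (S i)))) ≤
      ∫⁻ S', expGapSup φ ℓ Λ l
          ((MeasurableEquiv.sumPiEquivProdPi fun _ : Fin n ⊕ Fin n => 𝒳 × LabelVec c).symm (S, S'))
        ∂(Measure.pi fun _ : Fin n => D) := by
  have hm := measurable_surrogateLoss hφ hκm hρ.continuous.measurable W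
  have hint : Integrable (surrogateLoss φ ℓ W) D := integrable_of_mem_Icc hm (hB W hW)
  let J : (Fin n → 𝒳 × LabelVec c) → Fin n ⊕ Fin n → 𝒳 × LabelVec c := fun S' =>
    (MeasurableEquiv.sumPiEquivProdPi fun _ : Fin n ⊕ Fin n => 𝒳 × LabelVec c).symm (S, S')
  let X : (Fin n → 𝒳 × LabelVec c) → ℝ := fun S' => l * riskGap φ ℓ W (J S')
  have hX : ∀ S', X S' = l * ((1 / (n : ℝ)) * ∑ i, surrogateLoss φ ℓ W (S' i) -
      (1 / (n : ℝ)) * ∑ i, surrogateLoss φ ℓ W (S i)) := by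
    intro S'
    simp only [X, riskGap, Finset.sum_sub_distrib, mul_sub]
    rfl
  have hmX : Measurable X := by
    simp only [X, funext hX]
    fun_prop
  have hbd : ∀ S', |X S'| ≤ |l| * B := by
    intro S'
    have hmem : ∀ T : Fin n → 𝒳 × LabelVec c,
        (1 / (n : ℝ)) * ∑ i, surrogateLoss φ ℓ W (T i) ∈ Set.Icc 0 B := by
      intro T
      refine ⟨mul_nonneg (by positivity) (Finset.sum_nonneg fun i _ => (hB W hW _).1), ?_⟩
      have hn' : (0 : ℝ) < n := by positivity
      have : ∑ i, surrogateLoss φ ℓ W (T i) ≤ ∑ _i : Fin n, B :=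
        Finset.sum_le_sum fun i _ => (hB W hW _).2
      rw [one_div_mul_eq_div, div_le_iff₀ hn']
      simpa [mul_comm] using this
    rw [hX, abs_mul]
    gcongr
    exact abs_sub_le_of_mem_Icc (hmem _) (hmem _)
  have hXi : Integrable X (Measure.pi fun _ : Fin n => D) :=
    Integrable.of_bound hmX.aestronglyMeasurable (|l| * B) (ae_of_all _ hbd)
  have hXe : Integrable (fun S' => Real.exp (X S')) (Measure.pi fun _ : Fin n => D) :=
    Integrable.of_bound hmX.exp.aestronglyMeasurable (Real.exp (|l| * B)) (ae_of_all _ fun S' => by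
      rw [Real.norm_of_nonneg (Real.exp_pos _).le]
      exact Real.exp_le_exp.2 ((le_abs_self _).trans (hbd S')))
  have hmean : ∫ S', X S' ∂(Measure.pi fun _ : Fin n => D) = l * (∫ z, surrogateLoss φ ℓ W z ∂D -
        (1 / (n : ℝ)) * ∑ i, surrogateLoss φ ℓ W (S i)) := by
    have hmp := fun i => measurePreserving_eval (fun _ : Fin n => D) i
    simp only [hX]
    rw [integral_const_mul, integral_sub _ (integrable_const _), integral_average_pi hn D hint]
    · simp
    · exact (integrable_finsetSum _ fun i _ =>
        (hmp i).integrable_comp_of_integrable hint).const_mul _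
  -- Averaging over the ghost half turns its empirical risk into the true risk; convexity moves this
  -- average outside the exponential.
  have hjensen := convexOn_exp.map_integral_le (μ := Measure.pi fun _ : Fin n => D) (f := X)
    Real.continuous_exp.continuousOn isClosed_univ (ae_of_all _ fun _ => Set.mem_univ _) hXi hXe
  rw [hmean] at hjensen
  refine (ENNReal.ofReal_le_ofReal hjensen).trans ?_
  rw [ofReal_integral_eq_lintegral_ofReal hXe (ae_of_all _ fun _ => (Real.exp_pos _).le)]
  exact lintegral_mono fun S' => ofReal_exp_riskGap_le_expGapSup φ hρ l hW _

/-- The value `l = √(2 * n * L) / B` minimizes `l ^ 2 * B ^ 2 / (2 * n) - l * t` for `t = B * √(2 *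
L / n)`; the two terms are then `L` and `2 * L`. -/
lemma exponent_identities {n : ℕ} (hn : 1 ≤ n) {B L : ℝ} (hB : 0 < B) (hL : 0 ≤ L) :
    n * ((√(2 * n * L) / B) * (2 * B / n)) ^ 2 / 8 - (√(2 * n * L) / B) * (B * √(2 * L / n)) =
      -L := by
  have hn' : (0 : ℝ) < n := by positivity
  have h1 : √(2 * n * L) ^ 2 = 2 * n * L := Real.sq_sqrt (by positivity)
  have h2 : √(2 * n * L) * √(2 * L / n) = 2 * L := by
    rw [← Real.sqrt_mul (by positivity), show 2 * n * L * (2 * L / n) = (2 * L) ^ 2 by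
      field_simp]
    exact Real.sqrt_sq (by positivity)
  have h3 : (√(2 * n * L) / B) * (B * √(2 * L / n)) = 2 * L := by
    rw [← mul_assoc, div_mul_cancel₀ _ hB.ne', h2]
  have h4 : n * ((√(2 * n * L) / B) * (2 * B / n)) ^ 2 / 8 = √(2 * n * L) ^ 2 / (2 * n) := by
    field_simp
    ring
  rw [h3, h4, h1]
  field_simp
  ring

/-- The uniform deviation bound for the surrogate risk over the kernel class. -/
lemma holdsWithProb_surrogate_risk_le [CompleteSpace H] [Nonempty (Fin c)] (hn : 1 ≤ n)
    {κ : 𝒳 → 𝒳 → ℝ}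
    {φ : 𝒳 → H} (hφ : IsFeatureMap κ φ) (hκm : Measurable (Function.uncurry κ)) {r Λ B : ℝ}
    (hκr : ∀ x, κ x x ≤ r ^ 2) (hΛ : 0 ≤ Λ) (hB0 : 0 < B)
    {ℓ : ℝ → ℝ} {ρ : ℝ≥0} (hρ : LipschitzWith ρ ℓ)
    (hB : ∀ W : PiLp 2 (fun _ : Fin c => H), ‖W‖ ≤ Λ → ∀ z, surrogateLoss φ ℓ W z ∈ Set.Icc 0 B)
    (D : Measure (𝒳 × LabelVec c)) [IsProbabilityMeasure D] {δ : ℝ} (hδ : 0 < δ) (hδ1 : δ < 1) :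
    HoldsWithProb D n (1 - δ) fun S => ∀ W : PiLp 2 (fun _ : Fin c => H), ‖W‖ ≤ Λ →
      ∫ z, surrogateLoss φ ℓ W z ∂D ≤ (1 / (n : ℝ)) * ∑ i, surrogateLoss φ ℓ W (S i) +
        ((1 / (n : ℝ)) * (2 * (ρ * (Λ * √(c * (n * r ^ 2))))) +
          B * √(2 * Real.log (1 / δ) / n)) := by
  set Q := (1 / (n : ℝ)) * (2 * (ρ * (Λ * √(c * (n * r ^ 2)))))
  set L := Real.log (1 / δ)
  set t := B * √(2 * L / n)
  set l := √(2 * n * L) / B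
  have hn' : (0 : ℝ) < n := by positivity
  have hL : 0 < L := Real.log_pos (by rw [lt_div_iff₀ hδ]; linarith)
  have hl : 0 < l := by positivity
  set μ := Measure.pi fun _ : Fin n => D
  let e := MeasurableEquiv.sumPiEquivProdPi fun _ : Fin n ⊕ Fin n => 𝒳 × LabelVec c
  have he : MeasurePreserving e.symm (μ.prod μ) (Measure.pi fun _ : Fin n ⊕ Fin n => D) :=
    measurePreserving_sumPiEquivProdPi_symm fun _ : Fin n ⊕ Fin n => D
  have hm : Measurable (expGapSup φ ℓ Λ l : (Fin n ⊕ Fin n → 𝒳 × LabelVec c) → ENNReal) :=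
    measurable_expGapSup hφ hκm hρ.continuous.measurable Λ l
  let J : (Fin n → 𝒳 × LabelVec c) → ENNReal := fun S =>
    ∫⁻ S', expGapSup φ ℓ Λ l (e.symm (S, S')) ∂μ
  have hJ : Measurable J := (hm.comp e.symm.measurable).lintegral_prod_right'
  have hJint : ∫⁻ S, J S ∂μ ≤
      ENNReal.ofReal (Real.exp (l * Q + n * (l * (2 * B / n)) ^ 2 / 8)) := by
    have h := lintegral_prod (μ := μ) (ν := μ) _ (hm.comp e.symm.measurable).aemeasurable
    refine h.symm.le.trans ((he.lintegral_comp hm).le.trans ?_)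
    exact lintegral_expGapSup_le hφ hκm hκr hΛ hρ hB D hl.le
  let s := ENNReal.ofReal (Real.exp (l * (Q + t)))
  have hs : s ≠ 0 := by simp [s, Real.exp_pos]
  have hE : MeasurableSet {S | s ≤ J S} := measurableSet_le measurable_const hJ
  -- Markov's inequality for `J`, a measurable function that dominates the exponential deviations of
  -- all weights at once.
  have hbad : μ.real {S | s ≤ J S} ≤ δ := by
    refine ENNReal.toReal_le_of_le_ofReal hδ.le ?_
    refine (meas_ge_le_lintegral_div hJ.aemeasurable hs ENNReal.ofReal_ne_top).trans ?_
    refine ENNReal.div_le_of_le_mul (hJint.trans ?_)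
    rw [← ENNReal.ofReal_mul hδ.le]
    refine ENNReal.ofReal_le_ofReal (le_of_eq ?_)
    have hexp : Real.exp (-L) = δ := by
      rw [← Real.log_inv, one_div, inv_inv, Real.exp_log hδ]
    have hid : n * (l * (2 * B / n)) ^ 2 / 8 - l * t = -L := exponent_identities hn hB0 hL.le
    rw [← hexp, ← Real.exp_add]
    congr 1
    linarith
  refine ⟨{S | s ≤ J S}ᶜ, hE.compl, ?_, fun S hS W hW => ?_⟩
  · rw [probReal_compl_eq_one_sub hE]
    linarith
  · have h1 := (ofReal_exp_deviation_le hn hφ hκm hρ hB D l hW S).trans_lt (not_le.1 hS)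
    have h2 := Real.exp_lt_exp.1 ((ENNReal.ofReal_lt_ofReal_iff (Real.exp_pos _)).1 h1)
    have h3 := lt_of_mul_lt_mul_left h2 hl.le
    linarith

/-- Sup-norm contraction gives this term without the factor `√2`, which is pure slack. -/
lemma rademacher_term_le {ρ : ℝ≥0} {Λ r : ℝ} (hΛ : 0 ≤ Λ) (hn : 1 ≤ n) :
    (1 / (n : ℝ)) * (2 * (ρ * (Λ * √(c * (n * r ^ 2))))) ≤
      2 * √2 * ρ * √(c * Λ ^ 2 * r ^ 2 / n) := by
  have hn' : (0 : ℝ) < n := by positivity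
  have h : (1 / (n : ℝ)) * (Λ * √(c * (n * r ^ 2))) = √(c * Λ ^ 2 * r ^ 2 / n) := by
    rw [show c * Λ ^ 2 * r ^ 2 / n = (1 / (n : ℝ) * Λ) ^ 2 * (c * (n * r ^ 2)) by field_simp,
      Real.sqrt_mul (sq_nonneg (1 / (n : ℝ) * Λ)), Real.sqrt_sq (by positivity), mul_assoc]
  have h2 : 1 ≤ √2 := Real.one_le_sqrt.2 (by norm_num)
  calc _ = 2 * 1 * ρ * ((1 / (n : ℝ)) * (Λ * √(c * (n * r ^ 2)))) := by ring
    _ ≤ _ := by rw [h]; gcongr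

/-- After squaring, the constants compare as `2 ≤ 9 / 2`. -/
lemma confidence_term_le {B δ : ℝ} (hB : 0 ≤ B) (hδ : 0 < δ) (hδ1 : δ < 1) :
    B * √(2 * Real.log (1 / δ) / n) ≤ 3 * B * √(Real.log (2 / δ) / (2 * n)) := by
  have hlog : Real.log (1 / δ) ≤ Real.log (2 / δ) :=
    Real.log_le_log (by positivity) (by gcongr; norm_num)
  have hlog0 : 0 ≤ Real.log (1 / δ) := Real.log_nonneg (by rw [le_div_iff₀ hδ]; linarith)
  have h : √(2 * Real.log (1 / δ) / n) ≤ 3 * √(Real.log (2 / δ) / (2 * n)) := by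
    refine Real.sqrt_le_iff.2 ⟨by positivity, ?_⟩
    rw [mul_pow, Real.sq_sqrt (div_nonneg (hlog0.trans hlog) (by positivity))]
    rcases Nat.eq_zero_or_pos n with rfl | hn
    · simp
    · have hn' : (0 : ℝ) < n := Nat.cast_pos.2 hn
      rw [show (3 : ℝ) ^ 2 * (Real.log (2 / δ) / (2 * n)) = (9 / 2 * Real.log (2 / δ)) / n by
        field_simp; ring]
      gcongr
      linarith
  calc _ ≤ B * (3 * √(Real.log (2 / δ) / (2 * n))) := by gcongr
    _ = _ := by ring

end Risk

end MultiLabel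

theorem theorem4
    {𝒳 : Type*} [MeasurableSpace 𝒳]
    {H : Type*} [NormedAddCommGroup H] [InnerProductSpace ℝ H] [CompleteSpace H]
    (c n : ℕ) (hc : 1 ≤ c) (hn : 1 ≤ n)
    -- the kernel, its feature map, and the radius of the hypothesis set
    (κ : 𝒳 → 𝒳 → ℝ) (hκ : (Matrix.of κ).PosSemidef) (hκm : Measurable (Function.uncurry κ))
    (φ : 𝒳 → H) (hφ : IsFeatureMap κ φ)
    (r : ℝ) (hr : 0 < r) (hκr : ∀ x, κ x x ≤ r ^ 2)
    (Λ : ℝ)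
    -- the base loss: it upper bounds the 0/1 loss, is Lipschitz, and is bounded by `B` at the
    -- arguments that occur
    (ℓ : ℝ → ℝ) (h_zero_one : DominatesZeroOne ℓ)
    (ρ : ℝ≥0) (hρ : LipschitzWith ρ ℓ)
    (B : ℝ) (hB : ∀ f ∈ kernelClass c φ Λ, ∀ (x : 𝒳) (j : Fin c) (b : Label),
      ℓ ((b : ℝ) * f x j) ≤ B)
    -- the distribution of the data
    (D : Measure (𝒳 × LabelVec c)) [IsProbabilityMeasure D] :
    -- the surrogate subset loss is Lipschitz in the score vector
    (∀ y : LabelVec c, LipschitzWith ρ fun v : ScoreVec c => subsetSurrogate ℓ v y) ∧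
    -- the two 0/1 risks are expectations of integrable functions
    (∀ f ∈ kernelClass c φ Λ,
      Integrable (fun z => hammingLoss (signClassifier f z.1) z.2) D ∧
      Integrable (fun z => subsetLoss (signClassifier f z.1) z.2) D) ∧
    -- the generalization bounds
    ∀ δ : ℝ, 0 < δ → HoldsWithProb D n (1 - δ) fun S => ∀ f ∈ kernelClass c φ Λ,
      trueRisk D hammingLoss (signClassifier f) ≤ trueRisk D subsetLoss (signClassifier f) ∧
      trueRisk D subsetLoss (signClassifier f) ≤
        empiricalRisk (subsetSurrogate ℓ) S f
          + 2 * √2 * ρ * √(c * Λ ^ 2 * r ^ 2 / n)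
          + 3 * B * √(Real.log (2 / δ) / (2 * n)) := by
  have hne : Nonempty (Fin c) := ⟨⟨0, hc⟩⟩
  have hint : ∀ f ∈ kernelClass c φ Λ,
      Integrable (fun z => hammingLoss (signClassifier f z.1) z.2) D ∧
      Integrable (fun z => subsetLoss (signClassifier f z.1) z.2) D := by
    intro f hf
    obtain ⟨W, -, rfl⟩ := mem_kernelClass_iff.1 hf
    have hv : ∀ j, Measurable fun z : 𝒳 × LabelVec c => linearScore φ W z.1 j := fun j =>
      (measurable_inner_featureMap hφ hκm (W j)).comp measurable_fst
    exact ⟨integrable_of_mem_Icc (B := 1) (measurable_hammingLoss_sgn hv measurable_snd) fun z =>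
        ⟨hammingLoss_nonneg _ _, (hammingLoss_le_subsetLoss _ _).trans (subsetLoss_le_one _ _)⟩,
      integrable_of_mem_Icc (B := 1) (measurable_subsetLoss_sgn hv measurable_snd) fun z =>
        ⟨subsetLoss_nonneg _ _, subsetLoss_le_one _ _⟩⟩
  refine ⟨lipschitzWith_subsetSurrogate hρ, hint, fun δ hδ => ?_⟩
  rcases le_or_gt 1 δ with hδ1 | hδ1
  -- The required probability is not positive, so the empty event suffices.
  · exact ⟨∅, MeasurableSet.empty, by simpa using hδ1, fun S hS => hS.elim⟩
  rcases lt_or_ge Λ 0 with hΛ | hΛ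
  · refine ⟨Set.univ, MeasurableSet.univ, by simpa using hδ.le, fun S _ f hf => ?_⟩
    obtain ⟨W, hW, -⟩ := mem_kernelClass_iff.1 hf
    exact absurd ((norm_nonneg W).trans hW) hΛ.not_ge
  have hmem : ∀ W : PiLp 2 (fun _ : Fin c => H), ‖W‖ ≤ Λ → linearScore φ W ∈ kernelClass c φ Λ :=
    fun W hW => mem_kernelClass_iff.2 ⟨W, hW, rfl⟩
  have hbd : ∀ W : PiLp 2 (fun _ : Fin c => H), ‖W‖ ≤ Λ → ∀ z,
      surrogateLoss φ ℓ W z ∈ Set.Icc 0 B := fun W hW z =>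
    ⟨(subsetLoss_nonneg _ _).trans (subsetLoss_le_subsetSurrogate h_zero_one _ _),
      subsetSurrogate_le fun j => hB _ (hmem W hW) _ _ _⟩
  -- At the zero weight every score is `0`, and `sgn 0 = -1` errs on the label `1`; hence `1 ≤ ℓ 0 ≤
  -- B`.
  have hB0 : 0 < B := by
    obtain ⟨z⟩ := nonempty_of_isProbabilityMeasure D
    have h1 := h_zero_one 0 ⟨1, by simp⟩
    have h2 := hB _ (hmem 0 (by simpa using hΛ)) z.1 ⟨0, hc⟩ ⟨1, by simp⟩
    have h3 : zeroOne (sgn 0) ⟨1, by simp⟩ = 1 := by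
      have : (-1 : ℝ) ≠ 1 := by norm_num
      simp [zeroOne, sgn, this]
    simp only [linearScore_apply, PiLp.zero_apply, inner_zero_left, mul_zero] at h1 h2
    linarith
  obtain ⟨E, hE, hp, hbound⟩ :=
    holdsWithProb_surrogate_risk_le hn hφ hκm hκr hΛ hB0 hρ hbd D hδ hδ1
  refine ⟨E, hE, hp, fun S hS f hf => ⟨?_, ?_⟩⟩
  · exact integral_mono (hint f hf).1 (hint f hf).2 fun z => hammingLoss_le_subsetLoss _ _
  · have hf' := hint f hf
    obtain ⟨W, hW, rfl⟩ := mem_kernelClass_iff.1 hf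
    have h1 : trueRisk D subsetLoss (signClassifier (linearScore φ W)) ≤
        ∫ z, surrogateLoss φ ℓ W z ∂D :=
      integral_mono hf'.2 (integrable_of_mem_Icc
        (measurable_surrogateLoss hφ hκm hρ.continuous.measurable W) (hbd W hW))
        fun z => subsetLoss_le_subsetSurrogate h_zero_one _ _
    have h2 := hbound S hS W hW
    have h3 := rademacher_term_le (c := c) (ρ := ρ) (r := r) hΛ hn
    have h4 := confidence_term_le (n := n) hB0.le hδ hδ1
    change _ ≤ (1 / (n : ℝ)) * ∑ i, surrogateLoss φ ℓ W (S i) + _ + _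
    linarith
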